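/- Let $G$ be a finite simple undirected graph with vertex set $V(G)$, let $d_G(v)$ be the degree of $v$ in $G$, and for a graph $H$ let $\mathcal M(H)$ be the set of matchings of $H$ (sets of pairwise disjoint edges, including the empty set). For $M\in\mathcal M(H)$ let $V(M)$ be the set of endpoints of the edges in $M$. For an induced subgraph $H$ of $G$ put $$\beta(G,x)_{[H]}=\sum_{M\in\mathcal M(H)}(-1)^{|M|}\prod_{v\in V(H)\setminus V(M)}\bigl(x-d_G(v)\bigr),$$ and let $\beta(G,x)=\beta(G,x)_{[G]}$ be the Laplacian matching polynomial of $G$. Let $Q(G)=D(G)+A(G)$ be the signless Laplacian matrix of $G$, where $D(G)$ is the diagonal matrix of vertex degrees and $A(G)$ is the adjacency matrix, and let $Q(G)_{[H]}$ be the principal submatrix of $Q(G)$ indexed by $V(H)$. Let $\phi(N,x)=\det(xI-N)$ be the characteristic polynomial of a square matrix $N$ (equal to $1$ for the empty matrix), and let an empty product be $1$. Let $\mathcal C(G)$ be the set of all $2$-regular subgraphs of $G$ with at least one vertex (not necessarily induced or connected), for $C\in\mathcal C(G)$ let $\omega(C)$ be the number of connected components of $C$ (that is, the number of its cycles), and let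 $G-C$ be the subgraph of $G$ induced on $V(G)\setminus V(C)$. Then $$\phi(Q(G),x)=\beta(G,x)+\sum_{C\in\mathcal C(G)}(-2)^{\omega(C)}\,\beta(G,x)_{[G-C]}$$ and $$\beta(G,x)=\phi(Q(G),x)+\sum_{C\in\mathcal C(G)}2^{\omega(C)}\,\phi\bigl(Q(G)_{[G-C]},x\bigr).$$ -/

import Mathlib

open Polynomial

namespace LapMatching

variable {V : Type*}

/-- `M` is a matching all of whose edges lie in the edge set `E`: no two distinct edges in `M`
share an endpoint. The empty set is allowed. -/
def IsMatchingIn (E : Set (Sym2 V)) (M : Finset (Sym2 V)) : Prop :=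
  (∀ e ∈ M, e ∈ E) ∧ ∀ e ∈ M, ∀ f ∈ M, e ≠ f → ∀ v, v ∈ e → v ∉ f

/-- The vertex `v` is an endpoint of an edge in `M`, that is, `v ∈ V(M)`. -/
def IsCovered (M : Finset (Sym2 V)) (v : V) : Prop := ∃ e ∈ M, v ∈ e

section

variable [Fintype V] [DecidableEq V] (G : SimpleGraph V) [DecidableRel G.Adj]

open Classical in
/-- The Laplacian matching polynomial `β(G, x)`. -/
noncomputable def lapMatchingPoly : ℝ[X] :=
  ∑ M : Finset (Sym2 V) with IsMatchingIn G.edgeSet M,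
    (-1) ^ M.card * ∏ v : V with ¬ IsCovered M v, (X - C (G.degree v : ℝ))

open Classical in
/-- The principal Laplacian matching polynomial `β(G, x)_{[H]}` of `G` with respect to a subgraph
`H`: the matchings are those of `H`, the degrees are those in `G`. -/
noncomputable def principalLapMatchingPoly (H : G.Subgraph) : ℝ[X] :=
  ∑ M : Finset (Sym2 V) with IsMatchingIn H.edgeSet M,
    (-1) ^ M.card * ∏ v : V with v ∈ H.verts ∧ ¬ IsCovered M v, (X - C (G.degree v : ℝ))

/-- The signless Laplacian matrix `Q(G) = D(G) + A(G)`. -/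
def signlessLap : Matrix V V ℝ := G.degMatrix ℝ + G.adjMatrix ℝ

/-- The principal submatrix `Q(G)_{[H]}` of `Q(G)` indexed by the vertices of `H`. -/
def principalSignlessLap (H : G.Subgraph) : Matrix H.verts H.verts ℝ :=
  (signlessLap G).submatrix Subtype.val Subtype.val

open Classical in
/-- The characteristic polynomial `φ(Q(G)_{[H]}, x)`, equal to `1` if `H` has no vertices. -/
noncomputable def principalSignlessCharpoly (H : G.Subgraph) : ℝ[X] :=
  (principalSignlessLap G H).charpoly

end

/-- A `2`-regular subgraph: it has at least one vertex, and each of its vertices has exactly two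
neighbours in it. -/
def IsTwoRegular {G : SimpleGraph V} (C : G.Subgraph) : Prop :=
  C.verts.Nonempty ∧ ∀ v ∈ C.verts, (C.neighborSet v).ncard = 2

open Classical in
/-- The set `𝒞(G)` of all `2`-regular subgraphs of `G`. -/
noncomputable def twoRegularSubgraphs [Fintype V] (G : SimpleGraph V) : Finset G.Subgraph :=
  {C : G.Subgraph | IsTwoRegular C}

/-- The number `ω(C)` of connected components of a subgraph `C`. -/
noncomputable def numComponents {G : SimpleGraph V} (C : G.Subgraph) : ℕ :=
  Nat.card C.coe.ConnectedComponent

/-- `G - C`, the induced subgraph of `G` on the vertices outside `C`. -/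
def compl {G : SimpleGraph V} (C : G.Subgraph) : G.Subgraph :=
  (⊤ : G.Subgraph).induce (C.verts)ᶜ

end LapMatching

/-! In the Leibniz expansion of `det (xI - Q)` only permutations moving vertices to neighbours
survive. The sign together with the entries `-1` leaves `(-1)^c`, where `c` counts nontrivial
cycles, times `x - d(v)` over the fixed points (`det_eq_minorSum`). Matchings are the involutions
among these permutations, edges being 2-cycles, so `β` is the same sum restricted to involutions
(`sum_matchings_eq_involutionSum`).

Both identities sum over disjoint pairs `(τ, σ)`, with `τ` free of 2-cycles, grouped by the product
`π = τσ` (`sum_disjoint_signed`). For the first, `σ` is an involution: `π` splits uniquely into long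
cycles and 2-cycles (`minorSum_univ`). For the second, `σ` is arbitrary and `τ` carries no sign: the
choices of which long cycles of `π` go to `τ` cancel, unless `π` has none (`involutionSum_univ`).

Finally, each `τ ≠ 1` is a cyclic orientation of a unique 2-regular subgraph `C`, and each `C` has
`2^ω(C)` of them, with `ω(C)` cycles each (`sum_hasNoTwoCycle`). This turns the weights `(-1)^c` and
`1` into `(-2)^ω` and `2^ω`. -/

namespace LapMatching

open Equiv Equiv.Perm Finset

/-! ### Cycle decompositions and conditions tested cycle by cycle -/

section Cycles

variable {V : Type*} [Fintype V] [DecidableEq V]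

theorem mem_support_iff_exists_cycleFactor {σ : Perm V} {v : V} :
    v ∈ σ.support ↔ ∃ c ∈ σ.cycleFactorsFinset, v ∈ c.support :=
  mem_support_iff_mem_support_of_mem_cycleFactorsFinset

theorem support_eq_biUnion_cycleFactors (σ : Perm V) :
    σ.support = σ.cycleFactorsFinset.biUnion Perm.support := by
  ext v
  rw [mem_support_iff_exists_cycleFactor, mem_biUnion]

theorem exists_cycleFactorsFinset_eq {π : Perm V} {F : Finset (Perm V)}
    (hF : F ⊆ π.cycleFactorsFinset) : ∃ σ : Perm V, σ.cycleFactorsFinset = F := by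
  have hd : (F : Set (Perm V)).Pairwise Perm.Disjoint :=
    π.cycleFactorsFinset_pairwise_disjoint.mono (by exact_mod_cast hF)
  exact ⟨F.noncommProd id (hd.mono' fun _ _ => Perm.Disjoint.commute),
    cycleFactorsFinset_eq_finset.2
      ⟨fun f hf => (mem_cycleFactorsFinset_iff.1 (hF hf)).1, hd, rfl⟩⟩

/-- Disjoint pairs of permutations correspond to permutations with a distinguished set of
cycles. -/
theorem sum_disjoint_pairs {R : Type*} [AddCommMonoid R]
    (g : Finset (Perm V) → Finset (Perm V) → R) [DecidablePred fun p : Perm V × Perm V =>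
      Perm.Disjoint p.1 p.2] :
    ∑ p : Perm V × Perm V with Perm.Disjoint p.1 p.2,
        g p.1.cycleFactorsFinset p.2.cycleFactorsFinset =
      ∑ π : Perm V, ∑ F ∈ π.cycleFactorsFinset.powerset, g F (π.cycleFactorsFinset \ F) := by
  rw [Finset.sum_sigma']
  have key : ∀ p : Perm V × Perm V, Perm.Disjoint p.1 p.2 →
      (p.1 * p.2).cycleFactorsFinset \ p.1.cycleFactorsFinset = p.2.cycleFactorsFinset := by
    intro p hp
    rw [hp.cycleFactorsFinset_mul_eq_union]
    exact Finset.union_sdiff_cancel_left hp.disjoint_cycleFactorsFinset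
  refine Finset.sum_bij (fun p _ => ⟨p.1 * p.2, p.1.cycleFactorsFinset⟩) ?_ ?_ ?_ ?_
  · intro p hp
    have hp := (mem_filter.1 hp).2
    simp only [mem_sigma, mem_univ, true_and, mem_powerset]
    rw [hp.cycleFactorsFinset_mul_eq_union]
    exact subset_union_left
  · rintro ⟨p, q⟩ hp ⟨p', q'⟩ hp' h
    simp only [Sigma.mk.injEq, heq_eq_eq] at h
    obtain rfl := cycleFactorsFinset_injective h.2
    simpa using h.1
  · rintro ⟨π, F⟩ h
    simp only [mem_sigma, mem_univ, true_and, mem_powerset] at h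
    obtain ⟨σ, hσ⟩ := exists_cycleFactorsFinset_eq h
    obtain ⟨τ, hτ⟩ := exists_cycleFactorsFinset_eq (Finset.sdiff_subset (s := π.cycleFactorsFinset) (t := F))
    have hd : Perm.Disjoint σ τ := by
      rw [Perm.disjoint_iff_disjoint_support, Finset.disjoint_left]
      intro v hv hv'
      obtain ⟨c, hc, hvc⟩ := mem_support_iff_exists_cycleFactor.1 hv
      obtain ⟨d, hd, hvd⟩ := mem_support_iff_exists_cycleFactor.1 hv'
      rw [hσ] at hc
      rw [hτ, mem_sdiff] at hd
      have hcd : c ≠ d := by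
        rintro rfl
        exact hd.2 hc
      exact Finset.disjoint_left.1 (Perm.disjoint_iff_disjoint_support.1
        (π.cycleFactorsFinset_pairwise_disjoint (h hc) hd.1 hcd)) hvc hvd
    refine ⟨(σ, τ), mem_filter.2 ⟨mem_univ _, hd⟩, ?_⟩
    have : σ * τ = π := cycleFactorsFinset_injective (by
      rw [hd.cycleFactorsFinset_mul_eq_union, hσ, hτ, Finset.union_sdiff_of_subset h])
    simp [this, hσ]
  · intro p hp
    rw [key p (mem_filter.1 hp).2]

/-- Every vertex moved by `σ` is sent to one of its neighbours. -/
def IsCompatible (G : SimpleGraph V) (σ : Perm V) : Prop := ∀ v, σ v ≠ v → G.Adj v (σ v)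

/-- The permutation `σ` has no `2`-cycles. -/
def HasNoTwoCycle (σ : Perm V) : Prop := ∀ v, σ v ≠ v → σ (σ v) ≠ v

theorem isCompatible_iff_cycleFactors {G : SimpleGraph V} {σ : Perm V} :
    IsCompatible G σ ↔ ∀ c ∈ σ.cycleFactorsFinset, IsCompatible G c := by
  constructor
  · intro h c hc v hv
    have := (mem_cycleFactorsFinset_iff.1 hc).2 v (mem_support.2 hv)
    rw [this] at hv ⊢
    exact h v hv
  · intro h v hv
    obtain ⟨c, hc, hvc⟩ := mem_support_iff_exists_cycleFactor.1 (mem_support.2 hv)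
    rw [← (mem_cycleFactorsFinset_iff.1 hc).2 v hvc]
    exact h c hc v (mem_support.1 hvc)

theorem cycleFactor_apply_apply {σ c : Perm V} (hc : c ∈ σ.cycleFactorsFinset) {v : V}
    (hv : v ∈ c.support) : c (c v) = σ (σ v) := by
  have h := (mem_cycleFactorsFinset_iff.1 hc).2
  rw [h _ (apply_mem_support.2 hv), h v hv]

/-- A power of a cycle that fixes one point of its support is trivial. Hence being an involution and
having no 2-cycle are both conditions on the individual cycles. -/
theorem cycleFactor_sq_eq_one_iff {σ c : Perm V} (hc : c ∈ σ.cycleFactorsFinset) {v : V}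
    (hv : v ∈ c.support) : c * c = 1 ↔ σ (σ v) = v := by
  rw [← cycleFactor_apply_apply hc hv, ← sq,
    (mem_cycleFactorsFinset_iff.1 hc).1.pow_eq_one_iff' (mem_support.1 hv), sq, Perm.mul_apply]

theorem hasNoTwoCycle_iff_cycleFactors {σ : Perm V} :
    HasNoTwoCycle σ ↔ ∀ c ∈ σ.cycleFactorsFinset, c * c ≠ 1 := by
  constructor
  · intro h c hc
    obtain ⟨v, hv⟩ := (mem_cycleFactorsFinset_iff.1 hc).1.nonempty_support
    rw [Ne, cycleFactor_sq_eq_one_iff hc hv]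
    exact h v (mem_support.1 (mem_cycleFactorsFinset_support_le hc hv))
  · intro h v hv
    obtain ⟨c, hc, hvc⟩ := mem_support_iff_exists_cycleFactor.1 (mem_support.2 hv)
    exact fun h' => h c hc ((cycleFactor_sq_eq_one_iff hc hvc).2 h')

theorem mul_self_eq_one_iff_cycleFactors {σ : Perm V} :
    σ * σ = 1 ↔ ∀ c ∈ σ.cycleFactorsFinset, c * c = 1 := by
  constructor
  · intro h c hc
    obtain ⟨v, hv⟩ := (mem_cycleFactorsFinset_iff.1 hc).1.nonempty_support
    rw [cycleFactor_sq_eq_one_iff hc hv, ← Perm.mul_apply, h, Perm.one_apply]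
  · intro h
    ext v
    by_cases hv : v ∈ σ.support
    · obtain ⟨c, hc, hvc⟩ := mem_support_iff_exists_cycleFactor.1 hv
      rw [Perm.mul_apply, (cycleFactor_sq_eq_one_iff hc hvc).1 (h c hc), Perm.one_apply]
    · rw [notMem_support] at hv
      simp [hv]

end Cycles

/-! ### Signed sums over permutations and their inversion -/

section Sums

variable {V : Type*} [Fintype V] [DecidableEq V] {R : Type*} [CommRing R]

open Classical in
/-- The Leibniz expansion of the principal minor on `S` of the matrix with diagonal `w` and
off-diagonal part minus the adjacency matrix. -/
noncomputable def minorSum (G : SimpleGraph V) (w : V → R) (S : Finset V) : R :=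
  ∑ σ : Perm V with IsCompatible G σ ∧ σ.support ⊆ S,
    (-1) ^ σ.cycleFactorsFinset.card * ∏ v ∈ S \ σ.support, w v

open Classical in
/-- The part of `minorSum` coming from involutions. -/
noncomputable def involutionSum (G : SimpleGraph V) (w : V → R) (S : Finset V) : R :=
  ∑ σ : Perm V with (IsCompatible G σ ∧ σ.support ⊆ S) ∧ σ * σ = 1,
    (-1) ^ σ.cycleFactorsFinset.card * ∏ v ∈ S \ σ.support, w v

theorem support_subset_compl_support_iff {σ τ : Perm V} :
    σ.support ⊆ τ.supportᶜ ↔ Perm.Disjoint τ σ := by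
  rw [Perm.disjoint_iff_disjoint_support, Finset.subset_compl_iff_disjoint_right,
    _root_.disjoint_comm]

/-- The weight of a disjoint pair depends only on the two cycle sets, and its vertex product only on
their union. Grouping by the product `π` therefore leaves a signed count of the ways to share out
the cycles of `π`. The cases `ε = -1` and `ε = 1` serve the two identities. -/
theorem sum_disjoint_signed (p q : Perm V → Prop) [DecidablePred p] [DecidablePred q] (ε : R) (w : V → R) :
    ∑ τ : Perm V with ∀ c ∈ τ.cycleFactorsFinset, p c, ε ^ τ.cycleFactorsFinset.card *
        ∑ σ : Perm V with (∀ c ∈ σ.cycleFactorsFinset, q c) ∧ σ.support ⊆ τ.supportᶜ,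
          (-1) ^ σ.cycleFactorsFinset.card * ∏ v ∈ τ.supportᶜ \ σ.support, w v =
      ∑ π : Perm V, (∑ F ∈ π.cycleFactorsFinset.powerset with
          (∀ c ∈ F, p c) ∧ ∀ c ∈ π.cycleFactorsFinset \ F, q c,
        ε ^ F.card * (-1) ^ (π.cycleFactorsFinset \ F).card) * ∏ v ∈ π.supportᶜ, w v := by
  classical
  let g : Finset (Perm V) → Finset (Perm V) → R := fun A B =>
    if (∀ c ∈ A, p c) ∧ ∀ c ∈ B, q c then
      ε ^ A.card * (-1) ^ B.card * ∏ v ∈ (A.biUnion Perm.support)ᶜ \ B.biUnion Perm.support, w v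
    else 0
  trans ∑ P : Perm V × Perm V with Perm.Disjoint P.1 P.2,
        g P.1.cycleFactorsFinset P.2.cycleFactorsFinset
  · rw [sum_filter, sum_filter, Fintype.sum_prod_type]
    refine sum_congr rfl fun τ _ => ?_
    simp only [sum_filter, mul_sum, support_subset_compl_support_iff, g,
      ← support_eq_biUnion_cycleFactors]
    split_ifs with hτ
    · refine sum_congr rfl fun σ _ => ?_
      by_cases hd : Perm.Disjoint τ σ <;> by_cases hq : ∀ c ∈ σ.cycleFactorsFinset, q c <;>
        simp [hd, hq, and_iff_right hτ, mul_assoc]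
    · simp only [hτ, false_and, if_false, ite_self, sum_const_zero]
  · rw [sum_disjoint_pairs]
    refine sum_congr rfl fun π _ => ?_
    rw [sum_filter, sum_mul]
    refine sum_congr rfl fun F hF => ?_
    rw [ite_mul, zero_mul]
    refine if_congr Iff.rfl ?_ rfl
    rw [sdiff_eq_inter_compl (F.biUnion _)ᶜ, ← Finset.compl_union, ← Finset.union_biUnion,
      Finset.union_sdiff_of_subset (mem_powerset.1 hF), ← support_eq_biUnion_cycleFactors]

theorem isCompatible_and_hasNoTwoCycle_iff {G : SimpleGraph V} {σ : Perm V} :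
    IsCompatible G σ ∧ HasNoTwoCycle σ ↔
      ∀ c ∈ σ.cycleFactorsFinset, IsCompatible G c ∧ c * c ≠ 1 := by
  rw [isCompatible_iff_cycleFactors, hasNoTwoCycle_iff_cycleFactors, ← forall₂_and]

theorem isCompatible_and_mul_self_iff {G : SimpleGraph V} {σ : Perm V} :
    IsCompatible G σ ∧ σ * σ = 1 ↔
      ∀ c ∈ σ.cycleFactorsFinset, IsCompatible G c ∧ c * c = 1 := by
  rw [isCompatible_iff_cycleFactors, mul_self_eq_one_iff_cycleFactors, ← forall₂_and]

-- The conditions force `τ` to take exactly the cycles of `π` that are not 2-cycles, so a single `F`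
-- survives and the two signs multiply to that of `π`.
open Classical in
theorem minorSum_univ (G : SimpleGraph V) (w : V → R) :
    minorSum G w univ = ∑ τ : Perm V with IsCompatible G τ ∧ HasNoTwoCycle τ,
      (-1) ^ τ.cycleFactorsFinset.card * involutionSum G w τ.supportᶜ := by
  have := sum_disjoint_signed (fun c => IsCompatible G c ∧ c * c ≠ 1)
    (fun c => IsCompatible G c ∧ c * c = 1) (-1) w
  simp only [← isCompatible_and_hasNoTwoCycle_iff, ← isCompatible_and_mul_self_iff] at this
  simp only [involutionSum, and_right_comm]
  rw [this, minorSum, sum_filter]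
  refine sum_congr rfl fun π _ => ?_
  simp only [subset_univ, and_true, ← Finset.compl_eq_univ_sdiff]
  rw [← ite_zero_mul]
  congr 1
  set F := {c ∈ π.cycleFactorsFinset | c * c ≠ 1} with hF
  rw [sum_filter, Finset.sum_eq_single_of_mem F (mem_powerset.2 (filter_subset _ _))]
  · rw [← pow_add, add_comm, Finset.card_sdiff_add_card_eq_card (filter_subset _ _)]
    refine if_congr ?_ rfl rfl
    rw [isCompatible_iff_cycleFactors]
    simp only [hF, mem_sdiff, mem_filter]
    grind
  · intro A hA hAF
    refine if_neg ?_
    rintro ⟨h1, h2⟩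
    refine hAF ?_
    ext c
    have := mem_powerset.1 hA
    simp only [hF, mem_filter, mem_sdiff] at *
    grind

-- Here `F` may be any set of long cycles of `π`, with sign `(-1)^|F|` up to a constant. The
-- alternating sum over a powerset vanishes unless there are no long cycles, that is, unless `π` is
-- an involution.
open Classical in
theorem involutionSum_univ (G : SimpleGraph V) (w : V → R) :
    involutionSum G w univ = ∑ τ : Perm V with IsCompatible G τ ∧ HasNoTwoCycle τ,
      minorSum G w τ.supportᶜ := by
  have := sum_disjoint_signed (fun c => IsCompatible G c ∧ c * c ≠ 1)
    (fun c => IsCompatible G c) 1 w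
  simp only [← isCompatible_and_hasNoTwoCycle_iff, ← isCompatible_iff_cycleFactors, one_pow,
    one_mul] at this
  simp only [minorSum]
  rw [this, involutionSum, sum_filter]
  refine sum_congr rfl fun π _ => ?_
  simp only [subset_univ, and_true, ← Finset.compl_eq_univ_sdiff]
  rw [← ite_zero_mul]
  congr 1
  by_cases hπ : IsCompatible G π
  · have hc := isCompatible_iff_cycleFactors.1 hπ
    set F := {c ∈ π.cycleFactorsFinset | c * c ≠ 1} with hF
    have hfil : {A ∈ π.cycleFactorsFinset.powerset | (∀ c ∈ A, IsCompatible G c ∧ c * c ≠ 1) ∧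
        ∀ c ∈ π.cycleFactorsFinset \ A, IsCompatible G c} = F.powerset := by
      ext A
      simp only [hF, mem_filter, mem_powerset, mem_sdiff, subset_iff]
      grind
    rw [hfil]
    have hsign : ∀ A ∈ F.powerset, (-1 : R) ^ (π.cycleFactorsFinset \ A).card =
        (-1) ^ π.cycleFactorsFinset.card * (-1) ^ A.card := by
      intro A hA
      have hA : A ⊆ π.cycleFactorsFinset := (mem_powerset.1 hA).trans (filter_subset _ _)
      rw [← Finset.card_sdiff_add_card_eq_card hA, pow_add, mul_assoc, ← mul_pow]
      simp
    rw [sum_congr rfl hsign, ← mul_sum]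
    have hsum := congrArg (Int.cast : ℤ → R) (sum_powerset_neg_one_pow_card (x := F))
    push_cast at hsum
    rw [hsum, mul_ite, mul_one, mul_zero]
    refine if_congr ?_ rfl rfl
    rw [mul_self_eq_one_iff_cycleFactors]
    simp [hπ, hF, filter_eq_empty_iff]
  · rw [if_neg (fun h => hπ h.1), sum_eq_zero]
    intro A hA
    rw [mem_filter, mem_powerset] at hA
    refine (hπ (isCompatible_iff_cycleFactors.2 fun c hc => ?_)).elim
    by_cases h : c ∈ A
    · exact (hA.2.1 c h).1
    · exact hA.2.2 c (mem_sdiff.2 ⟨hc, h⟩)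

end Sums

/-! ### Determinants and matchings as sums over permutations -/

theorem natCard_eq_of_surjective_of_iff {α β γ : Type*} {f : α → β} {g : α → γ}
    (hf : Function.Surjective f) (hg : Function.Surjective g)
    (h : ∀ a b, f a = f b ↔ g a = g b) : Nat.card β = Nat.card γ := by
  have hk : Setoid.ker f = Setoid.ker g := Setoid.ext fun a b => h a b
  have e := Setoid.quotientKerEquivOfSurjective g hg
  rw [← hk] at e
  exact Nat.card_congr ((Setoid.quotientKerEquivOfSurjective f hf).symm.trans e)

section

variable {V : Type*} [Fintype V] [DecidableEq V]

/-- The cycles of `σ` are the classes of any surjection on the support that separates cycles. -/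
theorem card_cycleFactorsFinset_eq {β : Type*} {σ : Perm V} (g : {v // v ∈ σ.support} → β)
    (hg : Function.Surjective g) (h : ∀ u v, g u = g v ↔ σ.SameCycle u v) :
    σ.cycleFactorsFinset.card = Nat.card β := by
  have hf : Function.Surjective (fun v : σ.support =>
      (⟨σ.cycleOf v, cycleOf_mem_cycleFactorsFinset_iff.2 v.2⟩ : σ.cycleFactorsFinset)) := by
    rintro ⟨c, hc⟩
    obtain ⟨v, hv⟩ := (mem_cycleFactorsFinset_iff.1 hc).1.nonempty_support
    exact ⟨⟨v, mem_cycleFactorsFinset_support_le hc hv⟩, Subtype.ext (cycle_is_cycleOf hv hc).symm⟩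
  rw [← natCard_eq_of_surjective_of_iff hf hg, Nat.card_eq_fintype_card, Fintype.card_coe]
  intro u v
  rw [h, Subtype.mk.injEq, sameCycle_iff_cycleOf_eq_of_mem_support u.2 v.2]

theorem sign_cast_mul_neg_one_pow {R : Type*} [CommRing R] (σ : Perm V) :
    ((sign σ : ℤ) : R) * (-1) ^ σ.support.card = (-1) ^ σ.cycleFactorsFinset.card := by
  have : σ.cycleType.card = σ.cycleFactorsFinset.card := by
    rw [cycleType_def, Multiset.card_map, Finset.card_def]
  rw [sign_of_cycleType, sum_cycleType, this]
  push_cast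
  rw [pow_add, mul_right_comm, ← mul_pow]
  simp

-- Padding with the identity outside `S` keeps all permutations on `V`: those moving a point outside
-- `S`, or moving a vertex to a non-neighbour, meet a zero entry.
open Classical in
theorem det_eq_minorSum {R : Type*} [CommRing R] (G : SimpleGraph V) (w : V → R) (S : Finset V) :
    (Matrix.of fun i j => if i = j then (if i ∈ S then w i else 1) else
      if i ∈ S ∧ j ∈ S ∧ G.Adj i j then -1 else 0).det = minorSum G w S := by
  rw [Matrix.det_apply', minorSum, sum_filter]
  refine sum_congr rfl fun σ _ => ?_
  simp only [Matrix.of_apply]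
  split_ifs with h
  · obtain ⟨hc, hS⟩ := h
    rw [← Finset.prod_mul_prod_compl σ.support]
    have h1 : ∏ i ∈ σ.support, (if σ i = i then (if σ i ∈ S then w (σ i) else 1) else
        if σ i ∈ S ∧ i ∈ S ∧ G.Adj (σ i) i then -1 else 0) = (-1 : R) ^ σ.support.card := by
      rw [← prod_const]
      refine prod_congr rfl fun i hi => ?_
      rw [if_neg (mem_support.1 hi),
        if_pos ⟨hS (apply_mem_support.2 hi), hS hi, (hc i (mem_support.1 hi)).symm⟩]
    have h2 : ∏ i ∈ σ.supportᶜ, (if σ i = i then (if σ i ∈ S then w (σ i) else 1) else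
        if σ i ∈ S ∧ i ∈ S ∧ G.Adj (σ i) i then -1 else 0) = ∏ i ∈ S \ σ.support, w i := by
      rw [sdiff_eq_inter_compl, inter_comm, ← filter_mem_eq_inter, prod_filter]
      refine prod_congr rfl fun i hi => ?_
      have hi : σ i = i := by simpa using hi
      simp [hi]
    rw [h1, h2, ← mul_assoc, sign_cast_mul_neg_one_pow]
  · obtain ⟨i, hi⟩ : ∃ i, σ i ≠ i ∧ ¬ (σ i ∈ S ∧ i ∈ S ∧ G.Adj (σ i) i) := by
      by_contra! hcon
      exact h ⟨fun v hv => (hcon v hv).2.2.symm, fun v hv => (hcon v (mem_support.1 hv)).2.1⟩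
    rw [prod_eq_zero (mem_univ i), mul_zero]
    rw [if_neg hi.1, if_neg hi.2]

variable (G : SimpleGraph V) [DecidableRel G.Adj]

open Classical in
theorem charpoly_submatrix_signlessLap (s : Set V) :
    ((signlessLap G).submatrix (Subtype.val : s → V) Subtype.val).charpoly =
      minorSum G (fun v => X - C (G.degree v : ℝ)) {v | v ∈ s} := by
  rw [← det_eq_minorSum, Matrix.twoBlockTriangular_det _ (· ∈ s)]
  · rw [Matrix.charpoly]
    have h1 : ∀ (M : Matrix {v // v ∉ s} {v // v ∉ s} ℝ[X]), M = 1 → M.det = 1 := by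
      rintro _ rfl
      exact Matrix.det_one
    rw [h1 _ _, mul_one]
    · congr 1
      refine Matrix.ext fun i j => ?_
      by_cases hij : i = j
      · subst hij
        simp [Matrix.charmatrix_apply_eq, signlessLap, Matrix.toSquareBlockProp,
          SimpleGraph.degMatrix]
      · have : (i : V) ≠ j := fun h => hij (Subtype.ext h)
        by_cases hG : G.Adj i j <;>
        simp [Matrix.charmatrix_apply_ne, hij, signlessLap, Matrix.toSquareBlockProp,
          SimpleGraph.degMatrix, this, hG]
    · refine Matrix.ext fun i j => ?_
      have hi : (i : V) ∉ s := i.2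
      simp [Matrix.toSquareBlockProp, Matrix.one_apply, Subtype.ext_iff, hi]
  · intro i hi j hj
    have : i ≠ j := by
      rintro rfl
      exact hi hj
    simp [this, hi]

theorem charpoly_signlessLap :
    (signlessLap G).charpoly = minorSum G (fun v => X - C (G.degree v : ℝ)) univ := by
  rw [← det_eq_minorSum, Matrix.charpoly]
  congr 1
  refine Matrix.ext fun i j => ?_
  by_cases hij : i = j
  · subst hij
    simp [Matrix.charmatrix_apply_eq, signlessLap, SimpleGraph.degMatrix]
  · by_cases hG : G.Adj i j <;>
    simp [Matrix.charmatrix_apply_ne, hij, signlessLap, SimpleGraph.degMatrix, hG]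

omit [Fintype V] [DecidableEq V] in
theorem sameCycle_iff_of_mul_self {ρ : Perm V} (h : ρ * ρ = 1) {u v : V} :
    ρ.SameCycle u v ↔ u = v ∨ ρ u = v := by
  constructor
  · rintro ⟨i, rfl⟩
    obtain ⟨k, rfl | rfl⟩ := Int.even_or_odd' i
    · left
      rw [zpow_mul, show ρ ^ (2 : ℤ) = 1 by exact_mod_cast (sq ρ).trans h, one_zpow, one_apply]
    · right
      rw [zpow_add, zpow_mul, show ρ ^ (2 : ℤ) = 1 by exact_mod_cast (sq ρ).trans h, one_zpow,
        one_mul, zpow_one]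
  · rintro (rfl | rfl)
    · exact SameCycle.refl _ _
    · exact sameCycle_apply_right.2 (SameCycle.refl _ _)

/-- The edges joining the two points of each `2`-cycle of an involution. -/
def involutionEdges (ρ : Perm V) : Finset (Sym2 V) := ρ.support.image fun v => s(v, ρ v)

theorem mk_mem_involutionEdges {ρ : Perm V} (h : ρ * ρ = 1) {a b : V} :
    s(a, b) ∈ involutionEdges ρ ↔ ρ a ≠ a ∧ ρ a = b := by
  have h' : ∀ v, ρ (ρ v) = v := fun v => by rw [← Perm.mul_apply, h, Perm.one_apply]
  simp only [involutionEdges, mem_image, mem_support, Sym2.eq_iff]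
  constructor
  · rintro ⟨v, hv, ⟨rfl, rfl⟩ | ⟨rfl, rfl⟩⟩
    · exact ⟨hv, rfl⟩
    · exact ⟨fun e => hv (by rw [h'] at e; exact e.symm), h' _⟩
  · rintro ⟨h1, rfl⟩
    exact ⟨a, h1, Or.inl ⟨rfl, rfl⟩⟩

theorem isCovered_involutionEdges {ρ : Perm V} (h : ρ * ρ = 1) {v : V} :
    IsCovered (involutionEdges ρ) v ↔ v ∈ ρ.support := by
  rw [mem_support]
  constructor
  · rintro ⟨e, he, hv⟩
    obtain ⟨u, rfl⟩ := Sym2.mem_iff_exists.1 hv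
    exact ((mk_mem_involutionEdges h).1 he).1
  · intro hv
    exact ⟨s(v, ρ v), (mk_mem_involutionEdges h).2 ⟨hv, rfl⟩, Sym2.mem_mk_left _ _⟩

theorem card_involutionEdges {ρ : Perm V} (h : ρ * ρ = 1) :
    (involutionEdges ρ).card = ρ.cycleFactorsFinset.card := by
  have h' : ∀ v, ρ (ρ v) = v := fun v => by rw [← Perm.mul_apply, h, Perm.one_apply]
  rw [card_cycleFactorsFinset_eq (β := involutionEdges ρ)
    (fun v => ⟨s((v : V), ρ v), mem_image_of_mem _ v.2⟩)]
  · simp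
  · rintro ⟨e, he⟩
    obtain ⟨v, hv, rfl⟩ := mem_image.1 he
    exact ⟨⟨v, hv⟩, rfl⟩
  · intro u v
    rw [sameCycle_iff_of_mul_self h]
    refine (Subtype.ext_iff.trans Sym2.eq_iff).trans ?_
    constructor
    · rintro (h1 | h1)
      · exact Or.inl h1.1
      · exact Or.inr h1.2
    · rintro (h1 | h1)
      · exact Or.inl ⟨h1, by rw [h1]⟩
      · exact Or.inr ⟨by rw [← h1, h'], h1⟩

/-- Each covered vertex is swapped with its partner and every other vertex is fixed. Loops must be
excluded, since a loop would become a fixed point and be lost. -/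
theorem exists_involutionEdges_eq {E : Set (Sym2 V)} (hE : ∀ e ∈ E, ¬ e.IsDiag)
    {M : Finset (Sym2 V)} (hM : IsMatchingIn E M) :
    ∃ ρ : Perm V, ρ * ρ = 1 ∧ involutionEdges ρ = M := by
  have huniq : ∀ {v a b : V}, s(v, a) ∈ M → s(v, b) ∈ M → a = b := by
    intro v a b ha hb
    by_contra hab
    exact hM.2 _ ha _ hb (fun e => hab (Sym2.congr_right.1 e)) v
      (Sym2.mem_mk_left _ _) (Sym2.mem_mk_left _ _)
  have hex : ∀ v, ∃ u, s(v, u) ∈ M ∨ (u = v ∧ ¬ IsCovered M v) := by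
    intro v
    by_cases hv : IsCovered M v
    · obtain ⟨e, he, hve⟩ := hv
      obtain ⟨u, rfl⟩ := Sym2.mem_iff_exists.1 hve
      exact ⟨u, Or.inl he⟩
    · exact ⟨v, Or.inr ⟨rfl, hv⟩⟩
  choose p hp using hex
  have hp' : ∀ {a b}, s(a, b) ∈ M → p a = b := by
    intro a b hab
    rcases hp a with h | h
    · exact huniq h hab
    · exact (h.2 ⟨_, hab, Sym2.mem_mk_left _ _⟩).elim
  have hinv : Function.Involutive p := by
    intro v
    rcases hp v with h | h
    · exact hp' (Sym2.eq_swap ▸ h)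
    · rw [h.1, h.1]
  have hsq : hinv.toPerm * hinv.toPerm = 1 := by
    ext v
    simp [hinv v]
  refine ⟨hinv.toPerm, hsq, ?_⟩
  ext e
  induction e with | _ a b => ?_
  rw [mk_mem_involutionEdges hsq]
  simp only [Function.Involutive.coe_toPerm]
  constructor
  · rintro ⟨h1, rfl⟩
    rcases hp a with h | h
    · exact h
    · exact (h1 h.1).elim
  · intro h
    refine ⟨fun h1 => ?_, hp' h⟩
    rw [hp' h] at h1
    exact hE _ (hM.1 _ h) (by simp [h1])

theorem isMatchingIn_involutionEdges {E : Set (Sym2 V)} {ρ : Perm V} (h : ρ * ρ = 1) :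
    IsMatchingIn E (involutionEdges ρ) ↔ ∀ v, ρ v ≠ v → s(v, ρ v) ∈ E := by
  constructor
  · intro hM v hv
    exact hM.1 _ ((mk_mem_involutionEdges h).2 ⟨hv, rfl⟩)
  · intro hM
    refine ⟨fun e he => ?_, ?_⟩
    · obtain ⟨v, hv, rfl⟩ := mem_image.1 he
      exact hM v (mem_support.1 hv)
    · intro e he f hf hef v hve hvf
      obtain ⟨a, rfl⟩ := Sym2.mem_iff_exists.1 hve
      obtain ⟨b, rfl⟩ := Sym2.mem_iff_exists.1 hvf
      rw [mk_mem_involutionEdges h] at he hf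
      exact hef (by rw [← he.2, ← hf.2])

-- An involution corresponds to the matching of its 2-cycles, and its fixed points are the uncovered
-- vertices. Only membership in `E` is prescribed, so that `G` and `G - C` are covered together.
omit [DecidableRel G.Adj] in
open Classical in
theorem sum_matchings_eq_involutionSum {R : Type*} [CommRing R] (w : V → R) (s : Set V)
    {E : Set (Sym2 V)} (hE : ∀ a b, s(a, b) ∈ E ↔ G.Adj a b ∧ a ∈ s ∧ b ∈ s) :
    ∑ M : Finset (Sym2 V) with IsMatchingIn E M,
      (-1) ^ M.card * ∏ v : V with v ∈ s ∧ ¬ IsCovered M v, w v =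
    involutionSum G w {v | v ∈ s} := by
  have hiff : ∀ ρ : Perm V, ρ * ρ = 1 → (IsMatchingIn E (involutionEdges ρ) ↔
      IsCompatible G ρ ∧ ρ.support ⊆ ({v | v ∈ s} : Finset V)) := by
    intro ρ hρ
    rw [isMatchingIn_involutionEdges hρ]
    simp only [hE]
    constructor
    · intro h
      exact ⟨fun v hv => (h v hv).1, fun v hv => by simpa using (h v (mem_support.1 hv)).2.1⟩
    · rintro ⟨h1, h2⟩ v hv
      have h3 := h2 (mem_support.2 hv)
      have h4 := h2 (apply_mem_support.2 (mem_support.2 hv))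
      exact ⟨h1 v hv, by simpa using h3, by simpa using h4⟩
  symm
  refine sum_bij (fun ρ _ => involutionEdges ρ) ?_ ?_ ?_ ?_
  · intro ρ hρ
    simp only [mem_filter, mem_univ, true_and] at hρ ⊢
    exact (hiff ρ hρ.2).2 hρ.1
  · intro ρ hρ ρ' hρ' h
    replace hρ := (mem_filter.1 hρ).2.2
    replace hρ' := (mem_filter.1 hρ').2.2
    ext v
    by_cases hv : ρ v = v
    · have : ¬ IsCovered (involutionEdges ρ') v := by
        rw [← h, isCovered_involutionEdges hρ]
        simpa using hv
      rw [isCovered_involutionEdges hρ', notMem_support] at this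
      rw [hv, this]
    · have := (mk_mem_involutionEdges hρ).2 ⟨hv, rfl⟩
      rw [h, mk_mem_involutionEdges hρ'] at this
      exact this.2.symm
  · intro M hM
    replace hM := (mem_filter.1 hM).2
    obtain ⟨ρ, h1, rfl⟩ := exists_involutionEdges_eq (E := E) (fun e => by
      induction e with | _ a b => ?_
      intro hab h
      exact ((hE a b).1 hab).1.ne (by simpa using h)) hM
    exact ⟨ρ, by simpa [h1] using (hiff ρ h1).1 hM, rfl⟩
  · intro ρ hρ
    replace hρ := (mem_filter.1 hρ).2.2
    rw [card_involutionEdges hρ]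
    congr 2
    ext v
    simp [isCovered_involutionEdges hρ]

theorem lapMatchingPoly_eq_involutionSum :
    lapMatchingPoly G = involutionSum G (fun v => X - C (G.degree v : ℝ)) univ := by
  classical
  have := sum_matchings_eq_involutionSum G (fun v => X - C (G.degree v : ℝ)) Set.univ
    (E := G.edgeSet) (by simp)
  simpa only [lapMatchingPoly, Set.mem_univ, true_and, filter_true] using this

open Classical in
theorem principalLapMatchingPoly_compl (H : G.Subgraph) :
    principalLapMatchingPoly G (compl H) =
      involutionSum G (fun v => X - C (G.degree v : ℝ)) {v | v ∉ H.verts} := by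
  refine (sum_matchings_eq_involutionSum G (fun v => X - C (G.degree v : ℝ)) (H.verts)ᶜ
    (E := (compl H).edgeSet) ?_).trans ?_
  · intro a b
    simp [compl]
    tauto
  · simp

open Classical in
theorem principalSignlessCharpoly_compl (H : G.Subgraph) :
    principalSignlessCharpoly G (compl H) =
      minorSum G (fun v => X - C (G.degree v : ℝ)) {v | v ∉ H.verts} := by
  simpa [principalSignlessCharpoly, principalSignlessLap, compl] using
    charpoly_submatrix_signlessLap G (compl H).verts

end

/-! ### Cyclic orientations of 2-regular subgraphs: existence and number -/

section Orientations

variable {V : Type*} {G : SimpleGraph V}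

/-- A cyclic orientation of `C`: a permutation that moves each vertex of `C` to a neighbour in `C`,
without turning back, and fixes all other vertices. -/
structure IsOrientation (C : G.Subgraph) (τ : Perm V) : Prop where
  adj : ∀ v ∈ C.verts, C.Adj v (τ v)
  fixed : ∀ v ∉ C.verts, τ v = v
  apply_apply_ne : ∀ v ∈ C.verts, τ (τ v) ≠ v

namespace IsOrientation

variable {C : G.Subgraph} {τ τ₀ : Perm V}

theorem apply_mem_iff (h : IsOrientation C τ) {v : V} : τ v ∈ C.verts ↔ v ∈ C.verts := by
  by_cases hv : v ∈ C.verts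
  · exact iff_of_true (h.adj v hv).snd_mem hv
  · rw [h.fixed v hv]

theorem apply_ne_iff (h : IsOrientation C τ) {v : V} : τ v ≠ v ↔ v ∈ C.verts :=
  ⟨fun hv => by_contra fun hv' => hv (h.fixed v hv'), fun hv => (h.adj v hv).adj_sub.ne'⟩

theorem symm_adj (h : IsOrientation C τ) {v : V} (hv : v ∈ C.verts) : C.Adj v (τ.symm v) := by
  have h' : τ.symm v ∈ C.verts := h.apply_mem_iff.1 (by simpa using hv)
  simpa using (h.adj _ h').symm

theorem inv (h : IsOrientation C τ) : IsOrientation C τ⁻¹ where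
  adj v hv := h.symm_adj hv
  fixed v hv := by rw [Perm.inv_eq_iff_eq, h.fixed v hv]
  apply_apply_ne v hv e := by
    rw [Perm.inv_eq_iff_eq, Perm.inv_eq_iff_eq] at e
    exact h.apply_apply_ne v hv e.symm

/-- Since `τ` never turns back, `τ u` and `τ.symm u` are two distinct neighbours of `u`, and
2-regularity leaves no others. -/
theorem adj_iff (h : IsOrientation C τ) (hC : IsTwoRegular C) {u v : V} :
    C.Adj u v ↔ u ∈ C.verts ∧ (τ u = v ∨ τ v = u) := by
  constructor
  · intro huv
    have hu := huv.fst_mem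
    refine ⟨hu, ?_⟩
    have hne : τ u ≠ τ.symm u := fun e => h.apply_apply_ne u hu (by rw [e]; simp)
    have hsub : ({τ u, τ.symm u} : Set V) ⊆ C.neighborSet u := by
      rintro _ (rfl | rfl)
      · exact h.adj u hu
      · exact h.symm_adj hu
    have hfin : (C.neighborSet u).Finite :=
      Set.finite_of_ncard_ne_zero (by rw [hC.2 u hu]; decide)
    have heq := Set.eq_of_subset_of_ncard_le hsub
      (by rw [hC.2 u hu, Set.ncard_pair hne]) hfin
    have : v ∈ C.neighborSet u := huv
    rw [← heq] at this
    rcases this with rfl | rfl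
    · exact Or.inl rfl
    · exact Or.inr (by simp)
  · rintro ⟨hu, rfl | rfl⟩
    · exact h.adj u hu
    · exact (h.adj v (h.apply_mem_iff.1 hu)).symm

theorem apply_eq_or (h : IsOrientation C τ) (h₀ : IsOrientation C τ₀) (hC : IsTwoRegular C)
    {v : V} (hv : v ∈ C.verts) : τ v = τ₀ v ∨ τ₀ (τ v) = v :=
  ((h₀.adj_iff hC).1 (h.adj v hv)).2.imp Eq.symm id

theorem reachable_iff_sameCycle [Finite V] (h : IsOrientation C τ) (hC : IsTwoRegular C)
    (u v : C.verts) : C.coe.Reachable u v ↔ τ.SameCycle u v := by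
  constructor
  · intro huv
    rw [SimpleGraph.reachable_iff_reflTransGen] at huv
    induction huv with
    | refl => exact SameCycle.refl _ _
    | tail _ hab ih =>
      refine ih.trans ?_
      rcases ((h.adj_iff hC).1 hab).2 with e | e
      · exact e ▸ sameCycle_apply_right.2 (SameCycle.refl _ _)
      · exact e ▸ sameCycle_apply_left.2 (SameCycle.refl _ _)
  · intro huv
    obtain ⟨i, hi⟩ := huv.exists_nat_pow_eq
    induction i generalizing v with
    | zero =>
      obtain rfl : u = v := Subtype.ext hi
      rfl
    | succ i ih =>
      rw [pow_succ', Perm.mul_apply] at hi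
      have hm : (τ ^ i) u ∈ C.verts := h.apply_mem_iff.1 (hi ▸ v.2)
      refine (ih ⟨_, hm⟩ ⟨i, rfl⟩ rfl).trans (SimpleGraph.Adj.reachable ?_)
      have := h.adj _ hm
      rw [hi] at this
      exact this

/-- Agreement propagates along a cycle: if `τ u = τ₀ u` but `τ` differs from `τ₀` at the next
vertex, then `τ` goes straight back to `u`. So each component offers only two choices. -/
theorem agree_iff_of_sameCycle [Finite V] (h : IsOrientation C τ) (h₀ : IsOrientation C τ₀)
    (hC : IsTwoRegular C) {u v : V} (hu : u ∈ C.verts) (huv : τ₀.SameCycle u v) :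
    τ u = τ₀ u ↔ τ v = τ₀ v := by
  have step : ∀ u ∈ C.verts, (τ u = τ₀ u ↔ τ (τ₀ u) = τ₀ (τ₀ u)) := by
    intro u hu
    have hx : τ₀ u ∈ C.verts := h₀.apply_mem_iff.2 hu
    constructor
    · intro e
      refine (h.apply_eq_or h₀ hC hx).resolve_right fun e' => ?_
      refine h.apply_apply_ne u hu ?_
      rw [e, τ₀.injective e']
    · intro e
      -- The `τ`-predecessor of `τ₀ u` is either its `τ₀`-successor, which makes `τ` turn back, or
      -- `u` itself.
      rcases ((h₀.adj_iff hC).1 (h.symm_adj hx)).2 with e' | e'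
      · refine (h.apply_apply_ne _ (h.symm_adj hx).snd_mem ?_).elim
        rw [Equiv.apply_symm_apply, e, e']
      · rw [← Equiv.eq_symm_apply]
        exact (τ₀.injective e').symm
  obtain ⟨i, rfl⟩ := huv.exists_nat_pow_eq
  clear huv
  have hmem : ∀ i : ℕ, (τ₀ ^ i) u ∈ C.verts := by
    intro i
    induction i with
    | zero => exact hu
    | succ i ih => rw [pow_succ', Perm.mul_apply]; exact h₀.apply_mem_iff.2 ih
  induction i with
  | zero => rfl
  | succ i ih => rw [ih.trans (step _ (hmem i)), pow_succ', Perm.mul_apply]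

theorem card_cycleFactorsFinset [Fintype V] [DecidableEq V] (h : IsOrientation C τ)
    (hC : IsTwoRegular C) : τ.cycleFactorsFinset.card = numComponents C := by
  refine card_cycleFactorsFinset_eq (fun v => C.coe.connectedComponentMk
    ⟨v, h.apply_ne_iff.1 (mem_support.1 v.2)⟩) ?_ ?_
  · intro c
    obtain ⟨v, rfl⟩ := c.exists_rep
    exact ⟨⟨v, mem_support.2 (h.apply_ne_iff.2 v.2)⟩, rfl⟩
  · intro u v
    rw [SimpleGraph.ConnectedComponent.eq, h.reachable_iff_sameCycle hC]

/-- Reverse the orientation `τ₀` outside the invariant set `A`. -/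
theorem exists_piecewise (h₀ : IsOrientation C τ₀) (A : Set V)
    (hA : ∀ v, τ₀ v ∈ A ↔ v ∈ A) :
    ∃ τ, IsOrientation C τ ∧ (∀ v ∈ A, τ v = τ₀ v) ∧ ∀ v ∉ A, τ v = τ₀⁻¹ v := by
  classical
  have hA' : ∀ v, τ₀⁻¹ v ∈ A ↔ v ∈ A := fun v => by
    rw [← hA, ← Perm.mul_apply, mul_inv_cancel, Perm.one_apply]
  have hi : ∀ v, τ₀⁻¹ (τ₀ v) = v := τ₀.symm_apply_apply
  have hi' : ∀ v, τ₀ (τ₀⁻¹ v) = v := τ₀.apply_symm_apply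
  let τ : Perm V :=
    { toFun := fun v => if v ∈ A then τ₀ v else τ₀⁻¹ v
      invFun := fun v => if v ∈ A then τ₀⁻¹ v else τ₀ v
      left_inv := fun v => by
        by_cases hv : v ∈ A
        · simp only [if_pos hv, if_pos ((hA v).2 hv), hi]
        · simp only [if_neg hv, if_neg (mt (hA' v).1 hv), hi']
      right_inv := fun v => by
        by_cases hv : v ∈ A
        · simp only [if_pos hv, if_pos ((hA' v).2 hv), hi']
        · simp only [if_neg hv, if_neg (mt (hA v).1 hv), hi] }
  have h1 : ∀ v ∈ A, τ v = τ₀ v := fun v hv => if_pos hv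
  have h2 : ∀ v ∉ A, τ v = τ₀⁻¹ v := fun v hv => if_neg hv
  refine ⟨τ, ⟨?_, ?_, ?_⟩, h1, h2⟩ <;> intro v hv <;> by_cases hvA : v ∈ A
  · rw [h1 v hvA]; exact h₀.adj v hv
  · rw [h2 v hvA]; exact h₀.inv.adj v hv
  · rw [h1 v hvA]; exact h₀.fixed v hv
  · rw [h2 v hvA]; exact h₀.inv.fixed v hv
  · rw [h1 v hvA, h1 _ ((hA v).2 hvA)]; exact h₀.apply_apply_ne v hv
  · rw [h2 v hvA, h2 _ (mt (hA' v).1 hvA)]; exact h₀.inv.apply_apply_ne v hv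

/-- An orientation is determined by the set of components on which it agrees with `τ₀`, and every
set of components occurs by reversing `τ₀` on the others. -/
theorem natCard_eq [Finite V] (h₀ : IsOrientation C τ₀) (hC : IsTwoRegular C) :
    Nat.card {τ // IsOrientation C τ} = 2 ^ numComponents C := by
  classical
  have := Fintype.ofFinite C.coe.ConnectedComponent
  let Φ : {τ // IsOrientation C τ} → Set C.coe.ConnectedComponent := fun τ =>
    {c | ∃ v : C.verts, C.coe.connectedComponentMk v = c ∧ τ.1 v = τ₀ v}
  have hΦ : ∀ (τ : {τ // IsOrientation C τ}) (v : C.verts),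
      C.coe.connectedComponentMk v ∈ Φ τ ↔ τ.1 v = τ₀ v := by
    intro τ v
    refine ⟨?_, fun h => ⟨v, rfl, h⟩⟩
    rintro ⟨u, hu, h⟩
    rw [SimpleGraph.ConnectedComponent.eq, h₀.reachable_iff_sameCycle hC] at hu
    exact (τ.2.agree_iff_of_sameCycle h₀ hC u.2 hu).1 h
  have hbij : Function.Bijective Φ := by
    constructor
    · intro τ τ' e
      ext v
      by_cases hv : v ∈ C.verts
      · have h1 := hΦ τ ⟨v, hv⟩
        have h2 := hΦ τ' ⟨v, hv⟩
        rw [e] at h1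
        have h12 := h1.symm.trans h2
        rcases τ.2.apply_eq_or h₀ hC hv with h3 | h3
        · rw [h3, h12.1 h3]
        · rcases τ'.2.apply_eq_or h₀ hC hv with h4 | h4
          · rw [h4, h12.2 h4]
          · exact τ₀.injective (h3.trans h4.symm)
      · rw [τ.2.fixed v hv, τ'.2.fixed v hv]
    · intro S
      obtain ⟨τ, hτ, h1, h2⟩ := h₀.exists_piecewise
        {v | ∃ hv : v ∈ C.verts, C.coe.connectedComponentMk ⟨v, hv⟩ ∈ S} (by
          intro v
          by_cases hv : v ∈ C.verts
          · have hv' := h₀.apply_mem_iff.2 hv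
            have : C.coe.connectedComponentMk ⟨τ₀ v, hv'⟩ = C.coe.connectedComponentMk ⟨v, hv⟩ := by
              rw [SimpleGraph.ConnectedComponent.eq, h₀.reachable_iff_sameCycle hC]
              exact sameCycle_apply_left.2 (SameCycle.refl _ _)
            simp [hv, hv', this]
          · rw [h₀.fixed v hv])
      refine ⟨⟨τ, hτ⟩, ?_⟩
      ext c
      obtain ⟨v, rfl⟩ := c.exists_rep
      refine (hΦ ⟨τ, hτ⟩ v).trans ⟨fun e => ?_, fun hv => h1 v ⟨v.2, hv⟩⟩
      by_contra hv
      have h3 := h2 v (fun h => hv h.2)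
      refine h₀.apply_apply_ne v v.2 ?_
      rw [← Perm.eq_inv_iff_eq, ← h3]
      exact e.symm
  rw [Nat.card_congr (Equiv.ofBijective Φ hbij), Nat.card_eq_fintype_card, Fintype.card_set,
    numComponents, Nat.card_eq_fintype_card]

end IsOrientation

theorem IsTwoRegular.exists_ne_adj {C : G.Subgraph} (hC : IsTwoRegular C) {u v : V}
    (h : C.Adj u v) : ∃ w, w ≠ u ∧ C.Adj v w := by
  obtain ⟨x, y, hxy, he⟩ := Set.ncard_eq_two.1 (hC.2 v h.snd_mem)
  have hx : C.Adj v x := show x ∈ C.neighborSet v by simp [he]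
  have hy : C.Adj v y := show y ∈ C.neighborSet v by simp [he]
  by_cases hxu : x = u
  · exact ⟨y, fun e => hxy (hxu.trans e.symm), hy⟩
  · exact ⟨x, hxu, hx⟩

theorem IsTwoRegular.eq_of_ne_adj {C : G.Subgraph} (hC : IsTwoRegular C) {u v w w' : V}
    (h : C.Adj v u) (hw : C.Adj v w) (hw' : C.Adj v w') (hu : w ≠ u) (hu' : w' ≠ u) : w = w' := by
  obtain ⟨x, y, hxy, he⟩ := Set.ncard_eq_two.1 (hC.2 v h.fst_mem)
  have key : ∀ z, C.Adj v z → z = x ∨ z = y := fun z hz => by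
    have : z ∈ C.neighborSet v := hz
    simpa [he] using this
  rcases key _ h with rfl | rfl <;> rcases key _ hw with rfl | rfl <;>
    rcases key _ hw' with rfl | rfl <;> simp_all

/-- Let `τ` and `ρ` be permutations with `ρ` an involution inverting `τ` by conjugation. If `d` and
`ρ d` lie in the same cycle of `τ`, then `ρ` agrees somewhere with the identity or with `τ`. -/
theorem not_sameCycle_of_conj_eq_inv {D : Type*} {τ ρ : Perm D} (hρ : ρ * τ * ρ⁻¹ = τ⁻¹)
    (h1 : ∀ d, ρ d ≠ d) (h2 : ∀ d, τ d ≠ ρ d) (d : D) : ¬ τ.SameCycle d (ρ d) := by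
  have hconj : ∀ (k : ℤ) (d : D), ρ ((τ ^ k) d) = (τ ^ (-k)) (ρ d) := by
    intro k d
    have : ρ * τ ^ k = τ ^ (-k) * ρ := by
      rw [← mul_inv_eq_iff_eq_mul, ← conj_zpow, hρ, inv_zpow, zpow_neg]
    exact DFunLike.congr_fun this d
  rintro ⟨k, hk⟩
  -- `ρ` reflects the cycle; the midpoint `τ ^ j d` between `d` and `ρ d` is fixed when `k = 2j`,
  -- and is sent to its `τ`-successor when `k = 2j + 1`.
  obtain ⟨j, rfl | rfl⟩ := Int.even_or_odd' k
  · refine h1 ((τ ^ j) d) ?_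
    rw [hconj, ← hk, ← Perm.mul_apply, ← zpow_add]
    congr 2
    ring
  · refine h2 ((τ ^ j) d) ?_
    rw [hconj, ← hk, ← Perm.mul_apply, ← Perm.mul_apply, ← zpow_add, ← zpow_one_add]
    congr 2
    ring

/-- The edges of a `2`-regular graph can be directed consistently along each cycle. -/
theorem IsTwoRegular.exists_direction [Finite V] {C : G.Subgraph} (hC : IsTwoRegular C) :
    ∃ o : V → V → Prop, (∀ u v, C.Adj u v → (o v u ↔ ¬ o u v)) ∧
      ∀ u v w, C.Adj u v → C.Adj v w → w ≠ u → (o v w ↔ o u v) := by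
  -- The permutations act on directed edges: `t` advances without turning back and `r` reverses. The
  -- relation `t r t = r` says that `r` conjugates `t` to its inverse.
  let D := {p : V × V // C.Adj p.1 p.2}
  have hnx : ∀ d : D, ∃ w, w ≠ d.1.1 ∧ C.Adj d.1.2 w := fun d => hC.exists_ne_adj d.2
  choose nx hnx_ne hnx_adj using hnx
  let r : D → D := fun d => ⟨(d.1.2, d.1.1), d.2.symm⟩
  let t : D → D := fun d => ⟨(d.1.2, nx d), hnx_adj d⟩
  have hr : Function.Involutive r := fun d => rfl
  have ht_eq : ∀ (d : D) (w : V) (h : C.Adj d.1.2 w), w ≠ d.1.1 → t d = ⟨(d.1.2, w), h⟩ := by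
    intro d w h hw
    have := hC.eq_of_ne_adj d.2.symm (hnx_adj d) h (hnx_ne d) hw
    simp [t, this]
  have hrt : ∀ d, t (r (t d)) = r d := fun d =>
    ht_eq (r (t d)) d.1.1 d.2.symm (hnx_ne d).symm
  have ht : Function.Injective t := by
    intro d d' e
    have := hrt d
    rw [e, hrt d'] at this
    exact hr.injective this.symm
  let τ : Perm D := Equiv.ofBijective t (Finite.injective_iff_bijective.1 ht)
  let ρ : Perm D := hr.toPerm
  have hτ : ∀ d, τ d = t d := fun d => rfl
  have hρ : ∀ d, ρ d = r d := fun d => rfl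
  have hconj : ρ * τ * ρ⁻¹ = τ⁻¹ := by
    rw [mul_inv_eq_iff_eq_mul, eq_inv_mul_iff_mul_eq]
    ext1 d
    exact hrt d
  have hns := not_sameCycle_of_conj_eq_inv hconj
    (fun d e => d.2.ne (congrArg (fun x : D => x.1.2) e))
    (fun d e => hnx_ne d (congrArg (fun x : D => x.1.2) e))
  -- A directed edge and its reverse lie in different cycles of `τ`. Numbering the cycles by `κ`,
  -- each edge is directed the way that has the smaller number, a choice constant along `t`.
  let q := SameCycle.setoid τ
  let κ : D → Fin (Nat.card (Quotient q)) := fun d => Finite.equivFin (Quotient q) (Quotient.mk q d)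
  have hκ : ∀ d d', κ d = κ d' ↔ τ.SameCycle d d' := by
    intro d d'
    simp only [κ, EmbeddingLike.apply_eq_iff_eq]
    exact Quotient.eq
  have hκt : ∀ d, κ (t d) = κ d := fun d =>
    (hκ _ _).2 (sameCycle_apply_left.2 (SameCycle.refl _ _))
  have hκrt : ∀ d, κ (r (t d)) = κ (r d) := fun d => by rw [← hκt (r (t d)), hrt]
  have hκr : ∀ d, κ d ≠ κ (r d) := fun d e => hns d ((hκ _ _).1 e)
  refine ⟨fun u v => ∃ h : C.Adj u v, κ ⟨(u, v), h⟩ < κ (r ⟨(u, v), h⟩), ?_, ?_⟩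
  · intro u v h
    have := hκr ⟨(u, v), h⟩
    simp only [h, h.symm, exists_true_left, not_lt]
    exact ⟨le_of_lt, fun h' => lt_of_le_of_ne h' this.symm⟩
  · intro u v w huv hvw hwu
    simp only [huv, hvw, exists_true_left]
    have := ht_eq ⟨(u, v), huv⟩ w hvw hwu
    simp only at this
    rw [← this, hκt, hκrt]

/-- Consistency gives each vertex an outgoing edge, and `p` follows it. If two edges entered the
same vertex, continuing one would traverse the other backwards; so `p` is injective, hence bijective
by finiteness. -/
theorem IsTwoRegular.exists_isOrientation [Finite V] {C : G.Subgraph} (hC : IsTwoRegular C) :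
    ∃ τ, IsOrientation C τ := by
  obtain ⟨o, h1, h2⟩ := hC.exists_direction
  have hex : ∀ v, ∃ w, (v ∈ C.verts ∧ C.Adj v w ∧ o v w) ∨ (v ∉ C.verts ∧ w = v) := by
    intro v
    by_cases hv : v ∈ C.verts
    · obtain ⟨x, hx⟩ : (C.neighborSet v).Nonempty :=
        Set.nonempty_of_ncard_ne_zero (by rw [hC.2 v hv]; decide)
      obtain ⟨y, hyx, hy⟩ := hC.exists_ne_adj (C.adj_symm hx)
      by_cases hox : o v x
      · exact ⟨x, Or.inl ⟨hv, hx, hox⟩⟩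
      · exact ⟨y, Or.inl ⟨hv, hy, (h2 x v y (C.adj_symm hx) hy hyx).2 ((h1 v x hx).2 hox)⟩⟩
    · exact ⟨v, Or.inr ⟨hv, rfl⟩⟩
  choose p hp using hex
  have hin : ∀ v ∈ C.verts, C.Adj v (p v) ∧ o v (p v) := fun v hv =>
    ((hp v).resolve_right fun h => h.1 hv).2
  have hout : ∀ v ∉ C.verts, p v = v := fun v hv => ((hp v).resolve_left fun h => hv h.1).2
  have hinj : Function.Injective p := by
    intro u v e
    by_cases hu : u ∈ C.verts <;> by_cases hv : v ∈ C.verts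
    · obtain ⟨hu1, hu2⟩ := hin u hu
      obtain ⟨hv1, hv2⟩ := hin v hv
      rw [← e] at hv1 hv2
      by_contra hne
      exact (h1 v (p u) hv1).1 ((h2 u (p u) v hu1 hv1.symm (Ne.symm hne)).2 hu2) hv2
    · rw [hout v hv] at e
      exact (hv (e ▸ (hin u hu).1.snd_mem)).elim
    · rw [hout u hu] at e
      exact (hu (e ▸ (hin v hv).1.snd_mem)).elim
    · rwa [hout u hu, hout v hv] at e
  refine ⟨Equiv.ofBijective p (Finite.injective_iff_bijective.1 hinj), ⟨fun v hv => (hin v hv).1,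
    hout, fun v hv e => ?_⟩⟩
  obtain ⟨hv1, hv2⟩ := hin v hv
  have := (hin _ hv1.snd_mem).2
  rw [show p (p v) = v from e] at this
  exact (h1 _ _ hv1).1 this hv2

end Orientations

/-! ### Permutations without 2-cycles grouped by the subgraph they trace -/

section OrbitSubgraph

variable {V : Type*} (G : SimpleGraph V)

/-- The subgraph traced by a permutation. -/
def orbitSubgraph (τ : Perm V) : G.Subgraph where
  verts := {v | τ v ≠ v}
  Adj u v := G.Adj u v ∧ (τ u = v ∨ τ v = u)
  adj_sub h := h.1
  edge_vert := by
    rintro u v ⟨h, rfl | h'⟩ e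
    · exact h.ne e.symm
    · exact h.ne (τ.injective (e.trans h'.symm))
  symm := ⟨fun _ _ h => ⟨h.1.symm, h.2.symm⟩⟩

variable {G}

theorem isTwoRegular_orbitSubgraph {τ : Perm V} (hc : IsCompatible G τ) (h2 : HasNoTwoCycle τ)
    (h1 : τ ≠ 1) : IsTwoRegular (orbitSubgraph G τ) := by
  refine ⟨?_, fun v hv => ?_⟩
  · by_contra h
    refine h1 (Equiv.ext fun v => ?_)
    by_contra hv
    exact h ⟨v, hv⟩
  · have hv : τ v ≠ v := hv
    have hs : τ (τ.symm v) ≠ τ.symm v := fun e => hv (by simpa using congrArg τ e)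
    have : (orbitSubgraph G τ).neighborSet v = {τ v, τ.symm v} := by
      ext u
      simp only [SimpleGraph.Subgraph.mem_neighborSet, orbitSubgraph, Set.mem_insert_iff,
        Set.mem_singleton_iff, Equiv.eq_symm_apply]
      constructor
      · exact fun h => h.2.imp Eq.symm id
      · rintro (rfl | h)
        · exact ⟨hc v hv, Or.inl rfl⟩
        · obtain rfl : u = τ.symm v := by rw [← h]; simp
          exact ⟨by simpa using (hc _ hs).symm, Or.inr h⟩
    rw [this, Set.ncard_pair]
    exact fun e => h2 v hv (by rw [e]; simp)

theorem isOrientation_orbitSubgraph {τ : Perm V} (hc : IsCompatible G τ) (h2 : HasNoTwoCycle τ) :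
    IsOrientation (orbitSubgraph G τ) τ where
  adj v hv := ⟨hc v hv, Or.inl rfl⟩
  fixed _ hv := not_not.1 hv
  apply_apply_ne v hv := h2 v hv

theorem IsOrientation.isCompatible {C : G.Subgraph} {τ : Perm V} (h : IsOrientation C τ) :
    IsCompatible G τ := fun v hv => (h.adj v (h.apply_ne_iff.1 hv)).adj_sub

theorem IsOrientation.hasNoTwoCycle {C : G.Subgraph} {τ : Perm V} (h : IsOrientation C τ) :
    HasNoTwoCycle τ := fun v hv => h.apply_apply_ne v (h.apply_ne_iff.1 hv)

theorem IsOrientation.ne_one {C : G.Subgraph} {τ : Perm V} (h : IsOrientation C τ)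
    (hC : IsTwoRegular C) : τ ≠ 1 := by
  rintro rfl
  obtain ⟨v, hv⟩ := hC.1
  exact h.apply_ne_iff.2 hv rfl

/-- Together with `isOrientation_orbitSubgraph`, this identifies the fibre of `orbitSubgraph G` over
`C` with the orientations of `C`. -/
theorem IsOrientation.orbitSubgraph_eq {C : G.Subgraph} {τ : Perm V} (h : IsOrientation C τ)
    (hC : IsTwoRegular C) : orbitSubgraph G τ = C := by
  refine SimpleGraph.Subgraph.ext ?_ ?_
  · ext v
    exact h.apply_ne_iff
  · ext u v
    rw [h.adj_iff hC]
    constructor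
    · intro huv
      exact ⟨h.apply_ne_iff.1 ((orbitSubgraph G τ).edge_vert huv), huv.2⟩
    · intro huv
      exact ⟨((h.adj_iff hC).2 huv).adj_sub, huv.2⟩

theorem mem_twoRegularSubgraphs [Fintype V] {C : G.Subgraph} :
    C ∈ twoRegularSubgraphs G ↔ IsTwoRegular C := by
  simp [twoRegularSubgraphs]

open Classical in
/-- Sums over permutations without `2`-cycles, arranged by the subgraph they trace. -/
theorem sum_hasNoTwoCycle [Fintype V] [DecidableEq V] {R : Type*} [CommRing R]
    (F : ℕ → Finset V → R) :
    ∑ τ : Perm V with IsCompatible G τ ∧ HasNoTwoCycle τ, F τ.cycleFactorsFinset.card τ.support =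
      F 0 ∅ + ∑ C ∈ twoRegularSubgraphs G,
        2 ^ numComponents C * F (numComponents C) {v | v ∈ C.verts} := by
  have h1 : (1 : Perm V) ∈ ({τ | IsCompatible G τ ∧ HasNoTwoCycle τ} : Finset (Perm V)) := by
    exact mem_filter.2 ⟨mem_univ _, fun v hv => (hv rfl).elim, fun v hv => (hv rfl).elim⟩
  -- The identity traces the empty subgraph, which is not in `𝒞(G)`; it supplies the separate term
  -- `F 0 ∅`.
  rw [← Finset.add_sum_erase _ _ h1]
  congr 1
  · simp
  rw [← Finset.sum_fiberwise_of_maps_to (t := twoRegularSubgraphs G) (g := orbitSubgraph G)]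
  · refine sum_congr rfl fun C hC => ?_
    replace hC : IsTwoRegular C := mem_twoRegularSubgraphs.1 hC
    have hfib : {τ ∈ ({τ | IsCompatible G τ ∧ HasNoTwoCycle τ} : Finset (Perm V)).erase 1 |
        orbitSubgraph G τ = C} = ({τ | IsOrientation C τ} : Finset (Perm V)) := by
      ext τ
      simp only [mem_filter, mem_erase, mem_univ, true_and]
      constructor
      · rintro ⟨⟨-, hc, h2⟩, rfl⟩
        exact isOrientation_orbitSubgraph hc h2
      · intro h
        exact ⟨⟨h.ne_one hC, h.isCompatible, h.hasNoTwoCycle⟩, h.orbitSubgraph_eq hC⟩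
    rw [hfib]
    have hconst : ∀ τ ∈ ({τ | IsOrientation C τ} : Finset (Perm V)),
        F τ.cycleFactorsFinset.card τ.support = F (numComponents C) {v | v ∈ C.verts} := by
      intro τ hτ
      have h := (mem_filter.1 hτ).2
      rw [h.card_cycleFactorsFinset hC]
      congr 1
      ext v
      simpa using h.apply_ne_iff
    obtain ⟨τ₀, h₀⟩ := hC.exists_isOrientation
    have hcard : ({τ | IsOrientation C τ} : Finset (Perm V)).card = 2 ^ numComponents C := by
      rw [← h₀.natCard_eq hC, Nat.card_eq_fintype_card, Fintype.card_subtype]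
    rw [sum_congr rfl hconst, sum_const, nsmul_eq_mul, hcard, Nat.cast_pow, Nat.cast_ofNat]
  · intro τ hτ
    simp only [mem_erase, mem_filter, mem_univ, true_and] at hτ
    exact mem_twoRegularSubgraphs.2 (isTwoRegular_orbitSubgraph hτ.2.1 hτ.2.2 hτ.1)

end OrbitSubgraph

end LapMatching

theorem theorem4p2 {V : Type*} [Fintype V] [DecidableEq V] (G : SimpleGraph V)
    [DecidableRel G.Adj] :
    (LapMatching.signlessLap G).charpoly =
        LapMatching.lapMatchingPoly G +
          ∑ C ∈ LapMatching.twoRegularSubgraphs G,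
            (-2) ^ LapMatching.numComponents C *
              LapMatching.principalLapMatchingPoly G (LapMatching.compl C) ∧
      LapMatching.lapMatchingPoly G =
        (LapMatching.signlessLap G).charpoly +
          ∑ C ∈ LapMatching.twoRegularSubgraphs G,
            2 ^ LapMatching.numComponents C *
              LapMatching.principalSignlessCharpoly G (LapMatching.compl C) := by
  classical
  have hcompl : ∀ C : G.Subgraph, (({v | v ∈ C.verts} : Finset V))ᶜ =
      ({v | v ∉ C.verts} : Finset V) := fun C => by ext; simp
  rw [LapMatching.charpoly_signlessLap, LapMatching.lapMatchingPoly_eq_involutionSum]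
  constructor
  -- The sign `(-1) ^ n` is put into `F`, to merge with the count `2 ^ n` of orientations into `(-2)
  -- ^ n`.
  · rw [LapMatching.minorSum_univ, LapMatching.sum_hasNoTwoCycle (G := G) (fun n S => (-1) ^ n *
      LapMatching.involutionSum G (fun v => X - C (G.degree v : ℝ)) Sᶜ)]
    rw [pow_zero, one_mul, Finset.compl_empty]
    refine congrArg₂ (· + ·) rfl (Finset.sum_congr rfl fun C _ => ?_)
    rw [LapMatching.principalLapMatchingPoly_compl, hcompl, ← mul_assoc, ← mul_pow]
    norm_num
  · rw [LapMatching.involutionSum_univ, LapMatching.sum_hasNoTwoCycle (G := G) (fun n S =>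
      LapMatching.minorSum G (fun v => X - C (G.degree v : ℝ)) Sᶜ)]
    rw [Finset.compl_empty]
    refine congrArg₂ (· + ·) rfl (Finset.sum_congr rfl fun C _ => ?_)
    rw [LapMatching.principalSignlessCharpoly_compl, hcompl]
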